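/- Theorem. All Boolean algebras are allowed to be trivial ($0=1$); complements are written $a^*$. For a complete Boolean homomorphism $\varphi:A\to B$ between complete Boolean algebras let $\varphi_\Lambda:B\to A$ be its lower adjoint: $b\le\varphi(a)\iff\varphi_\Lambda(b)\le a$. A \emph{local contact algebra} $(B,\rho,\mathbb B)$ is a Boolean algebra $B$ with a binary relation $\rho$ on $B$ and a subset $\mathbb B\subseteq B$ such that, writing $a\ll_\rho b$ for "not $a\,\rho\,b^*$": (C1) $a\neq 0$ implies $a\rho a$; (C2) $a\rho b$ implies $a\ne0$ and $b\neq 0$; (C3) $a\rho b$ implies $b\rho a$; (C4) $a\rho(b\vee c)$ iff $a\rho b$ or $a\rho c$; (BB1) $0\in\mathbb B$; (BB2) $a\le b\in\mathbb B$ implies $a\in\mathbb B$; (BB3) $a,b\in\mathbb B$ implies $a\vee b\in\mathbb B$; (BC1) if $a\in\mathbb B$, $c\in B$ and $a\ll_\rho c$, then $a\ll_\rho b\ll_\rho c$ for some $b\in\mathbb B$; (BC2) if $a\rho b$ then $a\rho(c\wedge b)$ for some $c\in\mathbb B$; (BC3) if $a\ne0$ then $b\ll_\rho a$ for some $b\in\mathbb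 B\setminus\{0\}$. $\mathbf{OPAL}$ is the category of all complete local contact algebras (i.e. $B$ is a complete Boolean algebra); its morphisms $(A,\rho,\mathbb B)\to(B,\eta,\mathbb B')$ are the complete Boolean homomorphisms $\varphi:A\to B$ such that (L1) $\varphi(a)\,\eta\,\varphi(b)$ implies $a\rho b$; (L2) $b\in\mathbb B'$ implies $\varphi_\Lambda(b)\in\mathbb B$; (L3) $a\in\mathbb B$ implies $\varphi(a)\in\mathbb B'$; (LO) for $a\in A$ and $b\in\mathbb B'$, $\varphi_\Lambda(b)\,\rho\,a$ implies $b\,\eta\,\varphi(a)$. An \emph{MVD-algebra} $(B,\le,\ll)$ is a Boolean algebra with a binary relation $\ll$ such that: $a\ll b$ implies $a\le b$; $0\ll0$; $a\le b\ll c\le t$ implies $a\ll t$; $a\ll c$ and $b\ll c$ imply $a\vee b\ll c$; $a\ll c$ implies $a\ll b\ll c$ for some $b$; if $a\ne0$ then $b\ll a$ for some $b\neq0$; $a\ll b$ and $a\ll c$ imply $a\ll b\wedge c$; $a\ll1$ and $b^*\ll a^*$ imply $a\ll b$. $\mathbf{IPA}$ is the category of all complete MVD-algebras; its morphisms $(B,\le,\ll)\to(B',\le',\ll')$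 are the complete Boolean homomorphisms $\varphi:B\to B'$ such that (S2) $b\ll'1$ implies $\varphi_\Lambda(b)\ll1$; (ES1) $a\ll b$ implies $\varphi(a)\ll'\varphi(b)$; (S3) $a\ll1$ implies $\varphi(a)\ll'1$; (SO) for $a\in B$ and $b\in B'$, $b\ll'\varphi(a)$ implies $\varphi_\Lambda(b)\ll a$. (Complete Boolean homomorphisms satisfying the first three conditions are the $\mathbf{IA}$-morphisms.) $\mathbf{OPLC}$ is the category of all locally compact Hausdorff spaces and all open perfect maps, i.e. continuous maps that are open and closed and have compact point inverses. In all three categories composition is the usual composition of functions. Then the categories $\mathbf{OPAL}$ and $\mathbf{IPA}$ are isomorphic; hence the categories $\mathbf{OPLC}$ and $\mathbf{IPA}$ are dually equivalent. -/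

import Mathlib

open CategoryTheory

universe u

/- ### Lower adjoints of complete Boolean homomorphisms -/

/-- The lower adjoint `φ_Λ` of a complete homomorphism `φ : A → B`, i.e. the (unique) map
`φ_Λ : B → A` with `b ≤ φ a ↔ φ_Λ b ≤ a`; see `lowerAdjoint_gc`. -/
def lowerAdjoint {A B : Type u} [CompleteBooleanAlgebra A] [CompleteBooleanAlgebra B]
    (φ : CompleteLatticeHom A B) (b : B) : A :=
  sInf {a : A | b ≤ φ a}

theorem lowerAdjoint_gc {A B : Type u} [CompleteBooleanAlgebra A] [CompleteBooleanAlgebra B]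
    (φ : CompleteLatticeHom A B) : GaloisConnection (lowerAdjoint φ) (φ : A → B) := by
  intro b a
  constructor
  · intro h
    have h1 : b ≤ φ (sInf {a : A | b ≤ φ a}) := by
      rw [map_sInf]
      apply le_sInf
      rintro _ ⟨x, hx, rfl⟩
      exact hx
    exact h1.trans (OrderHomClass.mono φ h)
  · intro h
    exact sInf_le h

theorem lowerAdjoint_id {A : Type u} [CompleteBooleanAlgebra A] (a : A) :
    lowerAdjoint (CompleteLatticeHom.id A) a = a :=
  ((lowerAdjoint_gc (CompleteLatticeHom.id A)).l_unique GaloisConnection.id (fun _ => rfl))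

theorem lowerAdjoint_comp {A B C : Type u} [CompleteBooleanAlgebra A] [CompleteBooleanAlgebra B]
    [CompleteBooleanAlgebra C] (ψ : CompleteLatticeHom B C) (φ : CompleteLatticeHom A B) (c : C) :
    lowerAdjoint (ψ.comp φ) c = lowerAdjoint φ (lowerAdjoint ψ c) :=
  ((lowerAdjoint_gc (ψ.comp φ)).l_unique
    ((lowerAdjoint_gc ψ).compose (lowerAdjoint_gc φ)) (fun _ => rfl))

/- ### Contact algebras and local contact algebras -/

/-- `C` is a contact relation on the Boolean algebra `B`. -/
structure IsContactRel {B : Type u} [BooleanAlgebra B] (C : B → B → Prop) : Prop where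
  C1 : ∀ a, a ≠ ⊥ → C a a
  C2 : ∀ a b, C a b → a ≠ ⊥ ∧ b ≠ ⊥
  C3 : ∀ a b, C a b → C b a
  C4 : ∀ a b c, C a (b ⊔ c) ↔ C a b ∨ C a c

/-- Non-tangential inclusion `a ≪_C b`. -/
def NonTangIncl {B : Type u} [BooleanAlgebra B] (C : B → B → Prop) (a b : B) : Prop :=
  ¬ C a bᶜ

/-- `(B, ρ, 𝔹)` is a local contact algebra; the elements of `bdd` are the bounded ones. -/
structure IsLocalContact {B : Type u} [BooleanAlgebra B] (ρ : B → B → Prop) (bdd : Set B) :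
    Prop where
  contact : IsContactRel ρ
  BB1 : ⊥ ∈ bdd
  BB2 : ∀ a b, a ≤ b → b ∈ bdd → a ∈ bdd
  BB3 : ∀ a b, a ∈ bdd → b ∈ bdd → a ⊔ b ∈ bdd
  BC1 : ∀ a c, a ∈ bdd → NonTangIncl ρ a c →
    ∃ b ∈ bdd, NonTangIncl ρ a b ∧ NonTangIncl ρ b c
  BC2 : ∀ a b, ρ a b → ∃ c ∈ bdd, ρ a (c ⊓ b)
  BC3 : ∀ a, a ≠ ⊥ → ∃ b ∈ bdd, b ≠ ⊥ ∧ NonTangIncl ρ b a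

/-- Complete local contact algebras. -/
structure CompleteLCA : Type (u + 1) where
  carrier : Type u
  [str : CompleteBooleanAlgebra carrier]
  rel : carrier → carrier → Prop
  bdd : Set carrier
  isLocalContact : IsLocalContact rel bdd

attribute [instance] CompleteLCA.str

/-- The conditions on a complete Boolean homomorphism to be a **SKAL**-morphism. -/
structure IsSKALMor {A B : CompleteLCA.{u}} (φ : CompleteLatticeHom A.carrier B.carrier) :
    Prop where
  L1 : ∀ a b, B.rel (φ a) (φ b) → A.rel a b
  L2 : ∀ b, b ∈ B.bdd → lowerAdjoint φ b ∈ A.bdd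

/-- The conditions on a complete Boolean homomorphism to be a **SAL**-morphism. -/
structure IsSALMor {A B : CompleteLCA.{u}} (φ : CompleteLatticeHom A.carrier B.carrier) : Prop
    extends IsSKALMor φ where
  L3 : ∀ a, a ∈ A.bdd → φ a ∈ B.bdd

/-- The conditions on a complete Boolean homomorphism to be an **OPAL**-morphism. -/
structure IsOPALMor {A B : CompleteLCA.{u}} (φ : CompleteLatticeHom A.carrier B.carrier) : Prop
    extends IsSALMor φ where
  LO : ∀ a, ∀ b ∈ B.bdd, A.rel (lowerAdjoint φ b) a → B.rel b (φ a)

theorem isOPALMor_id (A : CompleteLCA.{u}) :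
    IsOPALMor (A := A) (B := A) (CompleteLatticeHom.id A.carrier) where
  L1 _ _ h := h
  L2 b hb := by rwa [lowerAdjoint_id]
  L3 _ h := h
  LO a b _ h := by rwa [lowerAdjoint_id] at h

theorem IsOPALMor.comp {A B C : CompleteLCA.{u}} {ψ : CompleteLatticeHom B.carrier C.carrier}
    {φ : CompleteLatticeHom A.carrier B.carrier} (hψ : IsOPALMor ψ) (hφ : IsOPALMor φ) :
    IsOPALMor (A := A) (B := C) (ψ.comp φ) where
  L1 a b h := hφ.L1 a b (hψ.L1 _ _ h)
  L2 c hc := by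
    rw [lowerAdjoint_comp]
    exact hφ.L2 _ (hψ.L2 _ hc)
  L3 a ha := hψ.L3 _ (hφ.L3 _ ha)
  LO a c hc h := by
    rw [lowerAdjoint_comp] at h
    exact hψ.LO _ c hc (hφ.LO a _ (hψ.L2 _ hc) h)

/-- The objects of the category **OPAL**: all complete local contact algebras. -/
def OPAL : Type (u + 1) := CompleteLCA.{u}

/-- The morphisms of **OPAL**. -/
@[ext]
structure OPALHom (A B : CompleteLCA.{u}) : Type u where
  toHom : CompleteLatticeHom A.carrier B.carrier
  isMor : IsOPALMor toHom

/-- The identity morphism. -/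
def OPALHom.id (A : CompleteLCA.{u}) : OPALHom A A :=
  ⟨CompleteLatticeHom.id A.carrier, isOPALMor_id A⟩

/-- Composition of morphisms (first `f`, then `g`) is composition of functions. -/
def OPALHom.comp {A B C : CompleteLCA.{u}} (f : OPALHom A B) (g : OPALHom B C) : OPALHom A C :=
  ⟨g.toHom.comp f.toHom, g.isMor.comp f.isMor⟩

instance : Category.{u} OPAL.{u} where
  Hom A B := OPALHom A B
  id A := OPALHom.id A
  comp f g := OPALHom.comp f g
  id_comp _ := rfl
  comp_id _ := rfl
  assoc _ _ _ := rfl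

/- ### MVD-algebras -/

/-- `(B, ≤, ≪)` is an MVD-algebra. -/
structure IsMVD {B : Type u} [BooleanAlgebra B] (ll : B → B → Prop) : Prop where
  ll1 : ∀ a b, ll a b → a ≤ b
  ll2 : ll ⊥ ⊥
  ll3 : ∀ a b c t, a ≤ b → ll b c → c ≤ t → ll a t
  ll4 : ∀ a b c, ll a c → ll b c → ll (a ⊔ b) c
  ll5 : ∀ a c, ll a c → ∃ b, ll a b ∧ ll b c
  ll6 : ∀ a, a ≠ ⊥ → ∃ b, b ≠ ⊥ ∧ ll b a
  ll4star : ∀ a b c, ll a b → ll a c → ll a (b ⊓ c)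
  MVD : ∀ a b, ll a ⊤ → ll bᶜ aᶜ → ll a b

/-- Complete MVD-algebras. -/
structure CompleteMVD : Type (u + 1) where
  carrier : Type u
  [str : CompleteBooleanAlgebra carrier]
  ll : carrier → carrier → Prop
  isMVD : IsMVD ll

attribute [instance] CompleteMVD.str

/-- The conditions on a complete Boolean homomorphism to be an **IA**-morphism. -/
structure IsIAMor {A B : CompleteMVD.{u}} (φ : CompleteLatticeHom A.carrier B.carrier) :
    Prop where
  S2 : ∀ b, B.ll b ⊤ → A.ll (lowerAdjoint φ b) ⊤
  ES1 : ∀ a b, A.ll a b → B.ll (φ a) (φ b)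
  S3 : ∀ a, A.ll a ⊤ → B.ll (φ a) ⊤

/-- The conditions on a complete Boolean homomorphism to be an **IPA**-morphism. -/
structure IsIPAMor {A B : CompleteMVD.{u}} (φ : CompleteLatticeHom A.carrier B.carrier) : Prop
    extends IsIAMor φ where
  SO : ∀ a b, B.ll b (φ a) → A.ll (lowerAdjoint φ b) a

theorem isIPAMor_id (A : CompleteMVD.{u}) :
    IsIPAMor (A := A) (B := A) (CompleteLatticeHom.id A.carrier) where
  S2 b hb := by rwa [lowerAdjoint_id]
  ES1 _ _ h := h
  S3 _ h := h
  SO a b h := by rwa [lowerAdjoint_id]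

theorem IsIPAMor.comp {A B C : CompleteMVD.{u}} {ψ : CompleteLatticeHom B.carrier C.carrier}
    {φ : CompleteLatticeHom A.carrier B.carrier} (hψ : IsIPAMor ψ) (hφ : IsIPAMor φ) :
    IsIPAMor (A := A) (B := C) (ψ.comp φ) where
  S2 c hc := by
    rw [lowerAdjoint_comp]
    exact hφ.S2 _ (hψ.S2 _ hc)
  ES1 a b h := hψ.ES1 _ _ (hφ.ES1 a b h)
  S3 a h := hψ.S3 _ (hφ.S3 a h)
  SO a c h := by
    rw [lowerAdjoint_comp]
    exact hφ.SO _ _ (hψ.SO _ _ h)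

/-- The objects of the category **IPA**: all complete MVD-algebras. -/
def IPA : Type (u + 1) := CompleteMVD.{u}

/-- The morphisms of **IPA**. -/
@[ext]
structure IPAHom (A B : CompleteMVD.{u}) : Type u where
  toHom : CompleteLatticeHom A.carrier B.carrier
  isMor : IsIPAMor toHom

/-- The identity morphism. -/
def IPAHom.id (A : CompleteMVD.{u}) : IPAHom A A :=
  ⟨CompleteLatticeHom.id A.carrier, isIPAMor_id A⟩

/-- Composition of morphisms (first `f`, then `g`) is composition of functions. -/
def IPAHom.comp {A B C : CompleteMVD.{u}} (f : IPAHom A B) (g : IPAHom B C) : IPAHom A C :=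
  ⟨g.toHom.comp f.toHom, g.isMor.comp f.isMor⟩

instance : Category.{u} IPA.{u} where
  Hom A B := IPAHom A B
  id A := IPAHom.id A
  comp f g := IPAHom.comp f g
  id_comp _ := rfl
  comp_id _ := rfl
  assoc _ _ _ := rfl

/- ### Locally compact Hausdorff spaces and open perfect maps -/

/-- Open perfect maps: continuous maps that are open, closed, and have compact fibres. -/
structure IsOpenPerfect {X Y : Type u} [TopologicalSpace X] [TopologicalSpace Y] (f : X → Y) :
    Prop where
  continuous : Continuous f
  isOpenMap : IsOpenMap f
  isClosedMap : IsClosedMap f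
  isCompact_fiber : ∀ y, IsCompact (f ⁻¹' {y})

theorem isOpenPerfect_id (X : Type u) [TopologicalSpace X] : IsOpenPerfect (id : X → X) where
  continuous := continuous_id
  isOpenMap := IsOpenMap.id
  isClosedMap := IsClosedMap.id
  isCompact_fiber _ := isCompact_singleton

theorem IsOpenPerfect.comp {X Y Z : Type u} [TopologicalSpace X] [TopologicalSpace Y]
    [TopologicalSpace Z] {g : Y → Z} {f : X → Y} (hg : IsOpenPerfect g) (hf : IsOpenPerfect f) :
    IsOpenPerfect (g ∘ f) where
  continuous := hg.continuous.comp hf.continuous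
  isOpenMap := hg.isOpenMap.comp hf.isOpenMap
  isClosedMap := hg.isClosedMap.comp hf.isClosedMap
  isCompact_fiber z :=
    (isProperMap_iff_isClosedMap_and_compact_fibers.2
      ⟨hf.continuous, hf.isClosedMap, hf.isCompact_fiber⟩).isCompact_preimage
        (hg.isCompact_fiber z)

/-- The objects of the category **OPLC**: all locally compact Hausdorff spaces. -/
structure OPLC : Type (u + 1) where
  carrier : Type u
  [top : TopologicalSpace carrier]
  [t2 : T2Space carrier]
  [locallyCompact : LocallyCompactSpace carrier]

attribute [instance] OPLC.top OPLC.t2 OPLC.locallyCompact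

/-- The morphisms of **OPLC**: open perfect maps. -/
@[ext]
structure OPLCHom (X Y : OPLC.{u}) : Type u where
  toFun : X.carrier → Y.carrier
  isOpenPerfect : IsOpenPerfect toFun

instance : Category.{u} OPLC.{u} where
  Hom X Y := OPLCHom X Y
  id X := ⟨id, isOpenPerfect_id X.carrier⟩
  comp f g := ⟨g.toFun ∘ f.toFun, g.isOpenPerfect.comp f.isOpenPerfect⟩

/- ### From local contact algebras to MVD-algebras -/

namespace IsContactRel

variable {B : Type u} [BooleanAlgebra B] {C : B → B → Prop}

/-! Local contact algebras and MVD-algebras carry the same data. From a contact relation and its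
bounded elements, let a ≪ b mean that a is bounded and non-tangentially included in b. Conversely,
call a bounded when a ≪ 1, and let a touch b when c ∧ b ≪ a* fails for some bounded c. BC2 says that
contact is detected on bounded pieces, so it is recovered (`mvdContact_bddNonTangIncl`). The MVD
axiom makes the second construction symmetric (`mvdContact_symm`), and ≪ is then recovered
(`nonTangIncl_mvdContact_iff_of_bdd`). Both constructions keep the underlying algebra and the
homomorphisms, so they are mutually inverse functors.

The duality is established for IPA directly. A space goes to its regular open sets, with U ≪ V when
the closure of U is compact and lies in V. Openness of a map makes preimage a complete homomorphism
and controls its lower adjoint; properness makes preimage preserve ≪. The functor is faithful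
because regular open sets separate points. It is essentially surjective because a complete
MVD-algebra is the regular open algebra of its space of round ≪-prime filters (`orderIso`; nonempty
basic sets come from `exists_mem`, compactness from `isCompact_closure_basicOpen`). It is full
because a morphism φ turns x into the filter of all U with x ∈ φ(U): SO makes it round, ES1 makes it
prime, and such a filter comes from a point of the space (`exists_eq_of_mvdPoint`). -/

theorem mono_right (h : IsContactRel C) {a b c : B} (hbc : b ≤ c) (hab : C a b) : C a c := by
  rw [← sup_eq_right.2 hbc, h.C4]
  exact Or.inl hab

theorem mono_left (h : IsContactRel C) {a b c : B} (hab : a ≤ b) (hac : C a c) : C b c :=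
  h.C3 _ _ (h.mono_right hab (h.C3 _ _ hac))

theorem not_bot_right (h : IsContactRel C) (a : B) : ¬ C a ⊥ := fun hc => (h.C2 _ _ hc).2 rfl

theorem not_bot_left (h : IsContactRel C) (a : B) : ¬ C ⊥ a := fun hc => (h.C2 _ _ hc).1 rfl

theorem of_inf_ne_bot (h : IsContactRel C) {a b : B} (hab : a ⊓ b ≠ ⊥) : C a b :=
  h.mono_right inf_le_right (h.mono_left inf_le_left (h.C1 _ hab))

theorem nonTangIncl_top (h : IsContactRel C) (a : B) : NonTangIncl C a ⊤ := by
  rw [NonTangIncl, compl_top]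
  exact h.not_bot_right a

end IsContactRel

/-- Bounded non-tangential inclusion. -/
def BddNonTangIncl {B : Type u} [BooleanAlgebra B] (ρ : B → B → Prop) (bdd : Set B) (a b : B) :
    Prop :=
  a ∈ bdd ∧ NonTangIncl ρ a b

/-- The contact relation of an MVD-algebra. -/
def MVDContact {B : Type u} [BooleanAlgebra B] (ll : B → B → Prop) (a b : B) : Prop :=
  ∃ c, ll c ⊤ ∧ ¬ ll (c ⊓ b) aᶜ

namespace IsLocalContact

variable {B : Type u} [BooleanAlgebra B] {ρ : B → B → Prop} {bdd : Set B}

theorem bddNonTangIncl_top (h : IsLocalContact ρ bdd) {a : B} :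
    BddNonTangIncl ρ bdd a ⊤ ↔ a ∈ bdd :=
  and_iff_left (h.contact.nonTangIncl_top a)

theorem isMVD (h : IsLocalContact ρ bdd) : IsMVD (BddNonTangIncl ρ bdd) where
  ll1 a b hab := by
    by_contra hle
    refine hab.2 (h.contact.of_inf_ne_bot fun h0 => hle ?_)
    rwa [← disjoint_iff, disjoint_compl_right_iff] at h0
  ll2 := ⟨h.BB1, h.contact.not_bot_left _⟩
  ll3 a b c t hab hbc hct := ⟨h.BB2 _ _ hab hbc.1, fun hc =>
    hbc.2 (h.contact.mono_left hab (h.contact.mono_right (compl_le_compl hct) hc))⟩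
  ll4 a b c hac hbc := by
    refine ⟨h.BB3 _ _ hac.1 hbc.1, fun hc => ?_⟩
    rcases (h.contact.C4 _ _ _).1 (h.contact.C3 _ _ hc) with h1 | h1
    · exact hac.2 (h.contact.C3 _ _ h1)
    · exact hbc.2 (h.contact.C3 _ _ h1)
  ll5 a c hac := by
    obtain ⟨b, hb, hab, hbc⟩ := h.BC1 a c hac.1 hac.2
    exact ⟨b, ⟨hac.1, hab⟩, hb, hbc⟩
  ll6 a ha := by
    obtain ⟨b, hb, hb0, hba⟩ := h.BC3 a ha
    exact ⟨b, hb0, hb, hba⟩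
  ll4star a b c hab hac := by
    refine ⟨hab.1, fun hc => ?_⟩
    rw [compl_inf, h.contact.C4] at hc
    exact hc.elim hab.2 hac.2
  MVD a b ha hba := by
    refine ⟨ha.1, fun hc => hba.2 ?_⟩
    rw [compl_compl]
    exact h.contact.C3 _ _ hc

theorem mvdContact_bddNonTangIncl (h : IsLocalContact ρ bdd) :
    MVDContact (BddNonTangIncl ρ bdd) = ρ := by
  funext a b
  refine propext ⟨?_, fun hab => ?_⟩
  · rintro ⟨c, hc, hn⟩
    by_contra hab
    refine hn ⟨h.BB2 _ _ inf_le_left hc.1, fun hρ => hab ?_⟩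
    rw [compl_compl] at hρ
    exact h.contact.C3 _ _ (h.contact.mono_left inf_le_right hρ)
  · obtain ⟨c, hc, hρ⟩ := h.BC2 a b hab
    refine ⟨c, h.bddNonTangIncl_top.2 hc, fun hn => hn.2 ?_⟩
    rw [compl_compl]
    exact h.contact.C3 _ _ hρ

end IsLocalContact

/- ### From MVD-algebras to local contact algebras -/

namespace IsMVD

variable {B : Type u} [BooleanAlgebra B] {ll : B → B → Prop}

theorem mono_left (h : IsMVD ll) {a b c : B} (hab : a ≤ b) (hbc : ll b c) : ll a c :=
  h.ll3 _ _ _ _ hab hbc le_rfl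

theorem mono_right (h : IsMVD ll) {a b c : B} (hab : ll a b) (hbc : b ≤ c) : ll a c :=
  h.ll3 _ _ _ _ le_rfl hab hbc

theorem bot_left (h : IsMVD ll) (a : B) : ll ⊥ a := h.mono_right h.ll2 bot_le

theorem top_of (h : IsMVD ll) {a b : B} (hab : ll a b) : ll a ⊤ := h.mono_right hab le_top

/-- The definition treats its two arguments differently; this is where the MVD axiom is needed. It
contraposes d ∧ a ≪ b* ≤ (c ∧ b)* to c ∧ b ≪ (d ∧ a)*, since c ∧ b is bounded. Choosing c ≪ d then
removes d by d ∧ (d ∧ a)* ≤ a*. -/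
theorem mvdContact_symm (h : IsMVD ll) {a b : B} (hab : MVDContact ll a b) :
    MVDContact ll b a := by
  obtain ⟨c, hc, hn⟩ := hab
  by_contra hba
  simp only [MVDContact, not_exists, not_and, not_not] at hba
  obtain ⟨d, hcd, hd⟩ := h.ll5 _ _ hc
  have h1 : ll (c ⊓ b) (d ⊓ a)ᶜ := by
    refine h.MVD _ _ (h.mono_left inf_le_left hc) ?_
    rw [compl_compl]
    exact h.mono_right (hba d hd) (compl_le_compl inf_le_right)
  refine hn (h.mono_right (h.ll4star _ _ _ (h.mono_left inf_le_left hcd) h1) ?_)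
  rw [compl_inf, inf_sup_left, inf_compl_self, bot_sup_eq]
  exact inf_le_right

theorem nonTangIncl_mvdContact_iff (h : IsMVD ll) {a b : B} :
    NonTangIncl (MVDContact ll) a b ↔ ∀ d, ll d ⊤ → ll (d ⊓ a) b := by
  have h1 : MVDContact ll a bᶜ ↔ MVDContact ll bᶜ a := ⟨h.mvdContact_symm, h.mvdContact_symm⟩
  rw [NonTangIncl, h1]
  simp only [MVDContact, not_exists, not_and, not_not, compl_compl]

/-- Symmetry turns the left side into "d ∧ a ≪ b for every bounded d"; a bounded a may itself serve
as d. -/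
theorem nonTangIncl_mvdContact_iff_of_bdd (h : IsMVD ll) {a b : B} (ha : ll a ⊤) :
    NonTangIncl (MVDContact ll) a b ↔ ll a b := by
  rw [h.nonTangIncl_mvdContact_iff]
  refine ⟨fun hd => ?_, fun hab d _ => h.mono_left inf_le_right hab⟩
  have := hd a ha
  rwa [inf_idem] at this

theorem isLocalContact (h : IsMVD ll) : IsLocalContact (MVDContact ll) {a | ll a ⊤} where
  contact :=
    { C1 := by
        intro a ha
        obtain ⟨b, hb, hba⟩ := h.ll6 a ha
        refine ⟨b, h.top_of hba, fun hn => hb ?_⟩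
        have h1 := h.ll1 _ _ hba
        rw [inf_eq_left.2 h1] at hn
        exact le_bot_iff.1 (inf_compl_self a ▸ le_inf h1 (h.ll1 _ _ hn))
      C2 := by
        rintro a b ⟨c, hc, hn⟩
        constructor
        · rintro rfl
          refine hn (h.mono_left inf_le_left ?_)
          rwa [compl_bot]
        · rintro rfl
          refine hn ?_
          rw [inf_bot_eq]
          exact h.bot_left _
      C3 := fun _ _ => h.mvdContact_symm
      C4 := by
        intro a b c
        constructor
        · rintro ⟨d, hd, hn⟩
          by_contra hor
          rw [not_or] at hor
          refine hn ?_
          rw [inf_sup_left]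
          refine h.ll4 _ _ _ ?_ ?_
          · by_contra h1
            exact hor.1 ⟨d, hd, h1⟩
          · by_contra h1
            exact hor.2 ⟨d, hd, h1⟩
        · rintro (⟨d, hd, hn⟩ | ⟨d, hd, hn⟩)
          · exact ⟨d, hd, fun h1 => hn (h.mono_left (inf_le_inf_left _ le_sup_left) h1)⟩
          · exact ⟨d, hd, fun h1 => hn (h.mono_left (inf_le_inf_left _ le_sup_right) h1)⟩ }
  BB1 := h.bot_left _
  BB2 _ _ hab hb := h.mono_left hab hb
  BB3 _ _ ha hb := h.ll4 _ _ _ ha hb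
  BC1 a c ha hac := by
    obtain ⟨b, hab, hbc⟩ := h.ll5 _ _ ((h.nonTangIncl_mvdContact_iff_of_bdd ha).1 hac)
    exact ⟨b, h.top_of hbc, (h.nonTangIncl_mvdContact_iff_of_bdd ha).2 hab,
      (h.nonTangIncl_mvdContact_iff_of_bdd (h.top_of hbc)).2 hbc⟩
  BC2 := by
    rintro a b ⟨c, hc, hn⟩
    refine ⟨c, hc, c, hc, ?_⟩
    rwa [← inf_assoc, inf_idem]
  BC3 a ha := by
    obtain ⟨b, hb, hba⟩ := h.ll6 a ha
    exact ⟨b, h.top_of hba, hb, (h.nonTangIncl_mvdContact_iff_of_bdd (h.top_of hba)).2 hba⟩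

theorem bddNonTangIncl_mvdContact (h : IsMVD ll) :
    BddNonTangIncl (MVDContact ll) {a | ll a ⊤} = ll := by
  funext a b
  refine propext ⟨fun hab => (h.nonTangIncl_mvdContact_iff_of_bdd hab.1).1 hab.2, fun hab => ?_⟩
  exact ⟨h.top_of hab, (h.nonTangIncl_mvdContact_iff_of_bdd (h.top_of hab)).2 hab⟩

end IsMVD

/-- The MVD-algebra of a complete local contact algebra. -/
def CompleteLCA.toMVD (A : CompleteLCA.{u}) : CompleteMVD.{u} where
  carrier := A.carrier
  ll := BddNonTangIncl A.rel A.bdd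
  isMVD := A.isLocalContact.isMVD

/-- The local contact algebra of a complete MVD-algebra. -/
def CompleteMVD.toLCA (A : CompleteMVD.{u}) : CompleteLCA.{u} where
  carrier := A.carrier
  rel := MVDContact A.ll
  bdd := {a | A.ll a ⊤}
  isLocalContact := A.isMVD.isLocalContact

/-- Round trips leave the carrier and its order untouched, so equality of objects comes down to
equality of relations. -/
theorem CompleteMVD.mk_congr {B : Type u} [CompleteBooleanAlgebra B] {ll ll' : B → B → Prop}
    {h : IsMVD ll} {h' : IsMVD ll'} (e : ll = ll') :
    CompleteMVD.mk B ll h = CompleteMVD.mk B ll' h' := by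
  subst e
  rfl

theorem CompleteLCA.mk_congr {B : Type u} [CompleteBooleanAlgebra B] {ρ ρ' : B → B → Prop}
    {bdd bdd' : Set B} {h : IsLocalContact ρ bdd} {h' : IsLocalContact ρ' bdd'}
    (e : ρ = ρ') (e' : bdd = bdd') :
    CompleteLCA.mk B ρ bdd h = CompleteLCA.mk B ρ' bdd' h' := by
  subst e e'
  rfl

theorem CompleteMVD.toMVD_toLCA (A : CompleteMVD.{u}) : A.toLCA.toMVD = A :=
  CompleteMVD.mk_congr A.isMVD.bddNonTangIncl_mvdContact

theorem CompleteLCA.toLCA_toMVD (A : CompleteLCA.{u}) : A.toMVD.toLCA = A :=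
  CompleteLCA.mk_congr A.isLocalContact.mvdContact_bddNonTangIncl
    (Set.ext fun _ => A.isLocalContact.bddNonTangIncl_top)

/-! ### Morphism conditions under the translation -/

theorem IsOPALMor.isIPAMor {A B : CompleteLCA.{u}} {φ : CompleteLatticeHom A.carrier B.carrier}
    (h : IsOPALMor φ) : IsIPAMor (A := A.toMVD) (B := B.toMVD) φ where
  S2 b hb :=
    A.isLocalContact.bddNonTangIncl_top.2 (h.L2 _ (B.isLocalContact.bddNonTangIncl_top.1 hb))
  S3 a ha :=
    B.isLocalContact.bddNonTangIncl_top.2 (h.L3 _ (A.isLocalContact.bddNonTangIncl_top.1 ha))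
  ES1 (a b : A.carrier) hab := by
    refine ⟨h.L3 _ hab.1, fun (hn : B.rel (φ a) (φ b)ᶜ) => hab.2 (h.L1 _ _ ?_)⟩
    rwa [map_compl']
  SO (a : A.carrier) (b : B.carrier) hba := by
    refine ⟨h.L2 _ hba.1, fun hn => hba.2 ?_⟩
    change B.rel b (φ a)ᶜ
    rw [← map_compl']
    exact h.LO _ _ hba.1 hn

theorem IsIPAMor.isOPALMor {A B : CompleteMVD.{u}} {φ : CompleteLatticeHom A.carrier B.carrier}
    (h : IsIPAMor φ) : IsOPALMor (A := A.toLCA) (B := B.toLCA) φ where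
  L1 := by
    rintro (a b : A.carrier) ⟨(d : B.carrier), hd, (hn : ¬ B.ll (d ⊓ φ b) (φ a)ᶜ)⟩
    -- A bounded witness upstairs is pushed down by the adjoint; d ≤ φ(φ_Λ(d)) lets ES1 carry the
    -- inclusion back up.
    refine ⟨lowerAdjoint φ d, h.S2 _ hd, fun hc => hn ?_⟩
    rw [← map_compl']
    refine B.isMVD.mono_left ?_ (h.ES1 _ _ hc)
    rw [map_inf]
    exact inf_le_inf_right _ ((lowerAdjoint_gc φ).le_u_l d)
  L2 b hb := h.S2 b hb
  L3 a ha := h.S3 a ha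
  LO (a : A.carrier) (b : B.carrier) (hb : B.ll b ⊤)
      (hab : MVDContact A.ll (lowerAdjoint φ b) a) := by
    change MVDContact B.ll b (φ a)
    by_contra hn
    have h1 : B.ll b (φ aᶜ) := by
      rw [map_compl', ← B.isMVD.nonTangIncl_mvdContact_iff_of_bdd hb, NonTangIncl, compl_compl]
      exact hn
    have h2 := (A.isMVD.nonTangIncl_mvdContact_iff_of_bdd (h.S2 _ hb)).2 (h.SO _ _ h1)
    rw [NonTangIncl, compl_compl] at h2
    exact h2 hab

/-- The functor from complete local contact algebras to complete MVD-algebras. -/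
def OPAL.toIPA : OPAL.{u} ⥤ IPA.{u} where
  obj A := CompleteLCA.toMVD A
  map f := ⟨f.toHom, f.isMor.isIPAMor⟩

/-- The functor from complete MVD-algebras to complete local contact algebras. -/
def IPA.toOPAL : IPA.{u} ⥤ OPAL.{u} where
  obj A := CompleteMVD.toLCA A
  map f := ⟨f.toHom, f.isMor.isOPALMor⟩

theorem OPALHom.hext {A A' B B' : CompleteLCA.{u}} (hA : A = A') (hB : B = B')
    {f : OPALHom A B} {g : OPALHom A' B'} (h : HEq f.toHom g.toHom) : HEq f g := by
  subst hA hB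
  exact heq_of_eq (OPALHom.ext (eq_of_heq h))

theorem IPAHom.hext {A A' B B' : CompleteMVD.{u}} (hA : A = A') (hB : B = B')
    {f : IPAHom A B} {g : IPAHom A' B'} (h : HEq f.toHom g.toHom) : HEq f g := by
  subst hA hB
  exact heq_of_eq (IPAHom.ext (eq_of_heq h))

/-- The categories **OPAL** and **IPA** are isomorphic. -/
def opalIsoIPA : Cat.of OPAL.{u} ≅ Cat.of IPA.{u} where
  hom := OPAL.toIPA.toCatHom
  inv := IPA.toOPAL.toCatHom
  hom_inv_id := by
    refine Cat.ext (Functor.hext CompleteLCA.toLCA_toMVD fun A B f => ?_)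
    exact OPALHom.hext (CompleteLCA.toLCA_toMVD A) (CompleteLCA.toLCA_toMVD B) HEq.rfl
  inv_hom_id := by
    refine Cat.ext (Functor.hext CompleteMVD.toMVD_toLCA fun A B f => ?_)
    exact IPAHom.hext (CompleteMVD.toMVD_toLCA A) (CompleteMVD.toMVD_toLCA B) HEq.rfl

/- ### The complete Boolean algebra of regular open sets -/

/-- Joins and meets are taken in the frame and regularised by double complement, which is left
adjoint to the inclusion of the regular elements. -/
instance Heyting.Regular.instCompleteBooleanAlgebra {α : Type u} [Order.Frame α] :
    CompleteBooleanAlgebra (Heyting.Regular α) :=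
  { (inferInstance : BooleanAlgebra (Heyting.Regular α)) with
    sSup := fun S => toRegular (sSup (val '' S))
    sInf := fun S => toRegular (sInf (val '' S))
    isLUB_sSup := fun S =>
      ⟨fun a ha => (le_sSup (Set.mem_image_of_mem val ha) : a.val ≤ _).trans le_compl_compl,
        fun b hb => gi.gc.l_le (sSup_le (by rintro _ ⟨a, ha, rfl⟩; exact hb ha))⟩
    isGLB_sInf := fun S =>
      ⟨fun a ha => gi.gc.l_le (sInf_le (Set.mem_image_of_mem val ha)),
        fun b hb => (le_sInf (by rintro _ ⟨a, ha, rfl⟩; exact hb ha) :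
          b.val ≤ sInf (val '' S)).trans le_compl_compl⟩ }

theorem Heyting.Regular.val_sSup {α : Type u} [Order.Frame α] (S : Set (Heyting.Regular α)) :
    (sSup S).val = (sSup (val '' S))ᶜᶜ := rfl

open TopologicalSpace

/-- The regular open sets of a topological space. -/
abbrev RegOpens (X : Type u) [TopologicalSpace X] : Type u := Heyting.Regular (Opens X)

theorem TopologicalSpace.Opens.coe_compl_eq_compl_closure {X : Type u} [TopologicalSpace X]
    (U : Opens X) : ((Uᶜ : Opens X) : Set X) = (closure (U : Set X))ᶜ := by
  rw [Opens.coe_compl_eq_interior_compl, _root_.interior_compl]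

/-- The pseudocomplement is the complement of the closure, and preimage under an open continuous map
commutes with closure. -/
theorem TopologicalSpace.Opens.comap_compl {X Y : Type u} [TopologicalSpace X]
    [TopologicalSpace Y] (f : C(X, Y)) (hf : IsOpenMap f) (U : Opens Y) :
    Opens.comap f Uᶜ = (Opens.comap f U)ᶜ := by
  apply Opens.ext
  rw [Opens.coe_comap, Opens.coe_compl_eq_compl_closure, Opens.coe_compl_eq_compl_closure,
    Set.preimage_compl, hf.preimage_closure_eq_closure_preimage f.continuous, Opens.coe_comap]

namespace RegOpens

section Basic

variable {X : Type u} [TopologicalSpace X]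

theorem mem_compl_iff {U : RegOpens X} {x : X} : x ∈ Uᶜ.val ↔ x ∉ closure (U.val : Set X) := by
  rw [← SetLike.mem_coe, Heyting.Regular.coe_compl, Opens.coe_compl_eq_compl_closure]
  rfl

theorem mem_closure_iff {U : RegOpens X} {x : X} : x ∈ closure (U.val : Set X) ↔ x ∉ Uᶜ.val := by
  rw [mem_compl_iff, not_not]

theorem le_iff {U V : RegOpens X} : U ≤ V ↔ (U.val : Set X) ⊆ V.val := Iff.rfl

theorem ext_mem {U V : RegOpens X} (h : ∀ x, x ∈ U.val ↔ x ∈ V.val) : U = V :=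
  Heyting.Regular.coe_injective (Opens.ext (Set.ext h))

theorem ne_bot_iff {U : RegOpens X} : U ≠ ⊥ ↔ ∃ x, x ∈ U.val := by
  rw [← not_iff_not, not_not, not_exists]
  refine ⟨?_, fun h => ext_mem fun x => ⟨fun hx => (h x hx).elim, fun hx => hx.elim⟩⟩
  rintro rfl x hx
  exact hx

/-- The interior of a closed set. -/
def interiorOfClosed (K : Set X) (hK : IsClosed K) : RegOpens X :=
  ⟨(⟨Kᶜ, hK.isOpen_compl⟩ : Opens X)ᶜ, Heyting.isRegular_compl _⟩

theorem coe_interiorOfClosed (K : Set X) (hK : IsClosed K) :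
    ((interiorOfClosed K hK).val : Set X) = interior K := by
  change (((⟨Kᶜ, hK.isOpen_compl⟩ : Opens X)ᶜ : Opens X) : Set X) = _
  rw [Opens.coe_compl_eq_compl_closure, Opens.coe_mk, closure_compl, compl_compl]

theorem closure_interiorOfClosed_subset (K : Set X) (hK : IsClosed K) :
    closure ((interiorOfClosed K hK).val : Set X) ⊆ K := by
  rw [coe_interiorOfClosed]
  exact closure_minimal interior_subset hK

theorem closure_sup_subset (U V : RegOpens X) :
    closure ((U ⊔ V).val : Set X) ⊆ closure (U.val : Set X) ∪ closure (V.val : Set X) := by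
  refine closure_minimal (fun x hx => ?_) (isClosed_closure.union isClosed_closure)
  by_contra h
  rw [Set.mem_union, not_or, ← mem_compl_iff, ← mem_compl_iff] at h
  have h1 : x ∈ (U ⊔ V)ᶜ.val := by
    rw [compl_sup]
    exact h
  exact mem_compl_iff.1 h1 (subset_closure hx)

/-- `U ≪ V` if the closure of `U` is compact and contained in `V`. -/
def CompactlyIn (U V : RegOpens X) : Prop :=
  IsCompact (closure (U.val : Set X)) ∧ closure (U.val : Set X) ⊆ V.val

theorem compactlyIn_top {U : RegOpens X} :
    CompactlyIn U ⊤ ↔ IsCompact (closure (U.val : Set X)) :=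
  and_iff_left (Set.subset_univ _)

end Basic

/-! ### Interpolation by relatively compact regular open sets -/

section LocallyCompact

variable {X : Type u} [TopologicalSpace X] [T2Space X] [LocallyCompactSpace X]

/-- Local compactness puts a compact L between K and s; as L is closed, its interior is regular
open. -/
theorem exists_compactlyIn_of_isCompact {K s : Set X} (hK : IsCompact K) (hs : IsOpen s)
    (hKs : K ⊆ s) : ∃ U : RegOpens X, K ⊆ U.val ∧ IsCompact (closure (U.val : Set X)) ∧
      closure (U.val : Set X) ⊆ s := by
  obtain ⟨L, hL, hKL, hLs⟩ := exists_compact_between hK hs hKs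
  have h := closure_interiorOfClosed_subset L hL.isClosed
  refine ⟨interiorOfClosed L hL.isClosed, ?_, hL.of_isClosed_subset isClosed_closure h,
    h.trans hLs⟩
  rwa [coe_interiorOfClosed]

theorem exists_mem_compactlyIn {x : X} {s : Set X} (hs : IsOpen s) (hx : x ∈ s) :
    ∃ U : RegOpens X, x ∈ U.val ∧ IsCompact (closure (U.val : Set X)) ∧
      closure (U.val : Set X) ⊆ s := by
  obtain ⟨U, hU, h⟩ := exists_compactlyIn_of_isCompact (isCompact_singleton (x := x)) hs
    (Set.singleton_subset_iff.2 hx)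
  exact ⟨U, hU rfl, h⟩

theorem eq_of_forall_mem {x y : X} (h : ∀ U : RegOpens X, x ∈ U.val → y ∈ U.val) : x = y := by
  by_contra hxy
  obtain ⟨U, hU, -, hUs⟩ := exists_mem_compactlyIn (isOpen_compl_singleton (x := y)) hxy
  exact hUs (subset_closure (h U hU)) rfl

theorem isMVD_compactlyIn : IsMVD (CompactlyIn (X := X)) where
  ll1 U V h := subset_closure.trans h.2
  ll2 := by
    have : ((⊥ : RegOpens X).val : Set X) = ∅ := rfl
    rw [CompactlyIn, this, closure_empty]
    exact ⟨isCompact_empty, Set.empty_subset _⟩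
  ll3 a b c t hab hbc hct :=
    ⟨hbc.1.of_isClosed_subset isClosed_closure (closure_mono (le_iff.1 hab)),
      (closure_mono (le_iff.1 hab)).trans (hbc.2.trans hct)⟩
  ll4 a b c hac hbc :=
    ⟨(hac.1.union hbc.1).of_isClosed_subset isClosed_closure (closure_sup_subset a b),
      (closure_sup_subset a b).trans (Set.union_subset hac.2 hbc.2)⟩
  ll5 a c hac := by
    obtain ⟨b, hab, hb, hbc⟩ := exists_compactlyIn_of_isCompact hac.1 c.val.isOpen hac.2
    exact ⟨b, ⟨hac.1, hab⟩, hb, hbc⟩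
  ll6 a ha := by
    obtain ⟨x, hx⟩ := ne_bot_iff.1 ha
    obtain ⟨b, hxb, hb, hba⟩ := exists_mem_compactlyIn a.val.isOpen hx
    exact ⟨b, ne_bot_iff.2 ⟨x, hxb⟩, hb, hba⟩
  ll4star a b c hab hac := ⟨hab.1, Set.subset_inter hab.2 hac.2⟩
  MVD a b ha hba := by
    refine ⟨ha.1, fun x hx => ?_⟩
    by_contra hxb
    refine mem_compl_iff.1 (hba.2 (mem_closure_iff.2 ?_)) hx
    rwa [compl_compl]

end LocallyCompact

/-! ### Preimages under open maps and their lower adjoints -/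

section Comap

variable {X Y : Type u} [TopologicalSpace X] [TopologicalSpace Y]

/-- The preimage of a regular open set under a continuous open map. -/
def preimage (f : C(X, Y)) (hf : IsOpenMap f) (U : RegOpens Y) : RegOpens X :=
  ⟨Opens.comap f U.val, by
    rw [Heyting.IsRegular, ← Opens.comap_compl f hf, ← Opens.comap_compl f hf, U.prop.eq]⟩

theorem preimage_compl (f : C(X, Y)) (hf : IsOpenMap f) (U : RegOpens Y) :
    preimage f hf Uᶜ = (preimage f hf U)ᶜ :=
  Heyting.Regular.coe_injective (Opens.comap_compl f hf U.val)

theorem preimage_sSup (f : C(X, Y)) (hf : IsOpenMap f) (S : Set (RegOpens Y)) :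
    preimage f hf (sSup S) = sSup (preimage f hf '' S) := by
  apply Heyting.Regular.coe_injective
  change Opens.comap f (sSup (Heyting.Regular.val '' S))ᶜᶜ = _
  rw [Opens.comap_compl f hf, Opens.comap_compl f hf, Heyting.Regular.val_sSup, map_sSup,
    Set.image_image, Set.image_image]
  rfl

/-- Taking preimages under a continuous open map, as a complete homomorphism. -/
def comap (f : C(X, Y)) (hf : IsOpenMap f) : CompleteLatticeHom (RegOpens Y) (RegOpens X) where
  toFun := preimage f hf
  map_sSup' := preimage_sSup f hf
  map_sInf' S := by
    rw [← compl_inj_iff, ← preimage_compl, compl_sInf', compl_sInf', preimage_sSup,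
      Set.image_image, Set.image_image]
    simp only [preimage_compl]

/-- The image of the closure of V is compact, hence closed, and its interior contains the open set
f(V). That interior is thus a regular open set whose preimage contains V, so it bounds the adjoint.
-/
theorem closure_lowerAdjoint_comap_subset [T2Space Y] (f : C(X, Y)) (hf : IsOpenMap f)
    {V : RegOpens X} (hV : IsCompact (closure (V.val : Set X))) :
    closure ((lowerAdjoint (comap f hf) V).val : Set Y) ⊆ f '' closure (V.val : Set X) := by
  have hK := (hV.image f.continuous).isClosed
  refine (closure_mono (le_iff.1 ?_)).trans (closure_interiorOfClosed_subset _ hK)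
  refine (lowerAdjoint_gc _ _ _).2 fun x hx => ?_
  change f x ∈ (interiorOfClosed _ hK).val
  rw [← SetLike.mem_coe, coe_interiorOfClosed]
  exact interior_maximal (Set.image_mono subset_closure) (hf _ V.val.isOpen)
    (Set.mem_image_of_mem f hx)

theorem CompactlyIn.lowerAdjoint_comap [T2Space Y] {f : C(X, Y)} {hf : IsOpenMap f}
    {U : RegOpens Y} {V : RegOpens X} (h : CompactlyIn V (comap f hf U)) :
    CompactlyIn (lowerAdjoint (comap f hf) V) U := by
  have h1 := closure_lowerAdjoint_comap_subset f hf h.1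
  exact ⟨(h.1.image f.continuous).of_isClosed_subset isClosed_closure h1,
    h1.trans (Set.image_subset_iff.2 h.2)⟩

theorem CompactlyIn.comap {f : C(X, Y)} {hf : IsOpenMap f} (hp : IsProperMap f)
    {U V : RegOpens Y} (h : CompactlyIn U V) : CompactlyIn (comap f hf U) (comap f hf V) := by
  have h1 : closure ((RegOpens.comap f hf U).val : Set X) = f ⁻¹' closure (U.val : Set Y) :=
    (hf.preimage_closure_eq_closure_preimage f.continuous _).symm
  rw [CompactlyIn, h1]
  exact ⟨hp.isCompact_preimage h.1, Set.preimage_mono h.2⟩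

end Comap

end RegOpens

/- ### The contravariant functor of regular open sets -/

/-- The MVD-algebra of regular open sets of a locally compact Hausdorff space. -/
def OPLC.toMVD (X : OPLC.{u}) : CompleteMVD.{u} where
  carrier := RegOpens X.carrier
  ll := RegOpens.CompactlyIn
  isMVD := RegOpens.isMVD_compactlyIn

theorem IsOpenPerfect.isProperMap {X Y : Type u} [TopologicalSpace X] [TopologicalSpace Y]
    {f : X → Y} (hf : IsOpenPerfect f) : IsProperMap f :=
  isProperMap_iff_isClosedMap_and_compact_fibers.2
    ⟨hf.continuous, hf.isClosedMap, hf.isCompact_fiber⟩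

/-- The morphism of MVD-algebras induced by an open perfect map. -/
def OPLCHom.toMVDHom {X Y : OPLC.{u}} (f : OPLCHom X Y) : IPAHom Y.toMVD X.toMVD where
  toHom := RegOpens.comap ⟨f.toFun, f.isOpenPerfect.continuous⟩ f.isOpenPerfect.isOpenMap
  isMor :=
    { S2 := fun _ hb => RegOpens.CompactlyIn.lowerAdjoint_comap (U := ⊤) hb
      ES1 := fun _ _ h => RegOpens.CompactlyIn.comap f.isOpenPerfect.isProperMap h
      S3 := fun _ h => RegOpens.CompactlyIn.comap f.isOpenPerfect.isProperMap h
      SO := fun _ _ h => RegOpens.CompactlyIn.lowerAdjoint_comap h }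

/-- The contravariant functor of regular open sets. -/
def regOpensFunctor : OPLC.{u}ᵒᵖ ⥤ IPA.{u} where
  obj X := X.unop.toMVD
  map f := OPLCHom.toMVDHom f.unop

instance regOpensFunctor_faithful : regOpensFunctor.{u}.Faithful where
  map_injective {X Y f g} h := by
    apply Quiver.Hom.unop_inj
    apply OPLCHom.ext
    funext x
    refine RegOpens.eq_of_forall_mem fun U hU => ?_
    have h1 : (OPLCHom.toMVDHom f.unop).toHom U = (OPLCHom.toMVDHom g.unop).toHom U :=
      congrArg (fun k : IPAHom X.unop.toMVD Y.unop.toMVD => k.toHom U) h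
    have h2 : x ∈ ((OPLCHom.toMVDHom f.unop).toHom U).val := hU
    rw [h1] at h2
    exact h2

/- ### The space of points of an MVD-algebra -/

/-- The points of an MVD-algebra: round proper filters that are prime with respect to `≪`. -/
@[ext]
structure MVDPoint {B : Type u} [BooleanAlgebra B] (ll : B → B → Prop) : Type u where
  carrier : Set B
  nonempty : carrier.Nonempty
  mem_of_le : ∀ {a b}, a ≤ b → a ∈ carrier → b ∈ carrier
  inf_mem : ∀ {a b}, a ∈ carrier → b ∈ carrier → a ⊓ b ∈ carrier
  bot_notMem : ⊥ ∉ carrier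
  round : ∀ {a}, a ∈ carrier → ∃ b ∈ carrier, ll b a
  prime : ∀ {a b}, ll a b → b ∈ carrier ∨ aᶜ ∈ carrier

namespace MVDPoint

section BooleanAlgebra

variable {B : Type u} [BooleanAlgebra B] {ll : B → B → Prop}

theorem compl_notMem (p : MVDPoint ll) {a : B} (ha : a ∈ p.carrier) : aᶜ ∉ p.carrier :=
  fun h => p.bot_notMem (inf_compl_self a ▸ p.inf_mem ha h)

/-- The round part of a filter that is prime with respect to `≪` and has a bounded element. -/
def ofPrimeFilter (h : IsMVD ll) (u : Set B) (mem_of_le : ∀ {a b}, a ≤ b → a ∈ u → b ∈ u)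
    (inf_mem : ∀ {a b}, a ∈ u → b ∈ u → a ⊓ b ∈ u) (bot_notMem : ⊥ ∉ u)
    (prime : ∀ {a b}, ll a b → b ∈ u ∨ aᶜ ∈ u) (bdd : ∃ t ∈ u, ll t ⊤) : MVDPoint ll where
  carrier := {c | ∃ d ∈ u, ll d c}
  nonempty := ⟨⊤, bdd⟩
  mem_of_le := fun hab ⟨d, hd, hda⟩ => ⟨d, hd, h.mono_right hda hab⟩
  inf_mem := fun ⟨d, hd, hda⟩ ⟨e, he, heb⟩ => ⟨d ⊓ e, inf_mem hd he,
    h.ll4star _ _ _ (h.mono_left inf_le_left hda) (h.mono_left inf_le_right heb)⟩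
  bot_notMem := fun ⟨d, hd, hd0⟩ => bot_notMem (mem_of_le (h.ll1 _ _ hd0) hd)
  round := fun ⟨d, hd, hda⟩ => by
    obtain ⟨e, hde, hea⟩ := h.ll5 _ _ hda
    exact ⟨e, ⟨d, hd, hde⟩, hea⟩
  prime := fun {a b} hab => by
    obtain ⟨m, ham, hmb⟩ := h.ll5 _ _ hab
    obtain ⟨k, hak, hkm⟩ := h.ll5 _ _ ham
    obtain ⟨t, ht, ht1⟩ := bdd
    rcases prime hkm with hm | hk
    · exact Or.inl ⟨m, hm, hmb⟩
    -- From a ≪ k alone, kᶜ ≪ aᶜ need not follow; meeting with the bounded t makes the MVD axiom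
    -- applicable.
    · refine Or.inr ⟨kᶜ ⊓ t, inf_mem hk ht, h.MVD _ _ (h.mono_left inf_le_right ht1) ?_⟩
      rw [compl_compl, compl_inf, compl_compl]
      exact h.mono_right hak le_sup_left

/-- The set of points containing a given element. -/
def basicOpen (ll : B → B → Prop) (a : B) : Set (MVDPoint ll) := {p | a ∈ p.carrier}

/-! ### Topology of the space of points -/

theorem mem_basicOpen {a : B} {p : MVDPoint ll} : p ∈ basicOpen ll a ↔ a ∈ p.carrier := Iff.rfl

instance : TopologicalSpace (MVDPoint ll) := generateFrom (Set.range (basicOpen ll))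

theorem isTopologicalBasis_basicOpen : IsTopologicalBasis (Set.range (basicOpen ll)) where
  exists_subset_inter := by
    rintro _ ⟨a, rfl⟩ _ ⟨b, rfl⟩ p hp
    exact ⟨_, ⟨a ⊓ b, rfl⟩, p.inf_mem hp.1 hp.2, fun q hq =>
      ⟨q.mem_of_le inf_le_left hq, q.mem_of_le inf_le_right hq⟩⟩
  sUnion_eq := Set.eq_univ_of_forall fun p =>
    let ⟨a, ha⟩ := p.nonempty
    ⟨_, ⟨a, rfl⟩, ha⟩
  eq_generateFrom := rfl

theorem isOpen_basicOpen (a : B) : IsOpen (basicOpen ll a) :=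
  isTopologicalBasis_basicOpen.isOpen ⟨a, rfl⟩

theorem basicOpen_mono {a b : B} (hab : a ≤ b) : basicOpen ll a ⊆ basicOpen ll b :=
  fun p hp => p.mem_of_le hab hp

theorem basicOpen_inf (a b : B) : basicOpen ll (a ⊓ b) = basicOpen ll a ∩ basicOpen ll b :=
  (Set.subset_inter (basicOpen_mono inf_le_left) (basicOpen_mono inf_le_right)).antisymm
    fun p hp => p.inf_mem hp.1 hp.2

theorem basicOpen_bot : basicOpen ll ⊥ = ∅ := Set.eq_empty_of_forall_notMem fun p => p.bot_notMem

theorem basicOpen_union_of_ll {a b : B} (hab : ll a b) :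
    basicOpen ll b ∪ basicOpen ll aᶜ = Set.univ :=
  Set.eq_univ_of_forall fun p => p.prime hab

theorem disjoint_basicOpen_compl (a : B) : Disjoint (basicOpen ll a) (basicOpen ll aᶜ) :=
  Set.disjoint_left.2 fun p hp => p.compl_notMem hp

/-- Points are maximal: for b ≪ a with b in q, primeness of p offers a or b*, and b* is excluded
because it would lie in q. -/
theorem carrier_injective_of_le {p q : MVDPoint ll} (h : p.carrier ⊆ q.carrier) : p = q := by
  refine MVDPoint.ext (h.antisymm fun a ha => ?_)
  obtain ⟨b, hb, hba⟩ := q.round ha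
  exact (p.prime hba).resolve_right fun hbc => q.compl_notMem hb (h hbc)

instance : T2Space (MVDPoint ll) where
  t2 p q hpq := by
    have h : ¬ p.carrier ⊆ q.carrier := fun h => hpq (carrier_injective_of_le h)
    obtain ⟨a, hap, haq⟩ := Set.not_subset.1 h
    obtain ⟨b, hb, hba⟩ := p.round hap
    exact ⟨_, _, isOpen_basicOpen b, isOpen_basicOpen bᶜ, hb, (q.prime hba).resolve_left haq,
      disjoint_basicOpen_compl b⟩

/-- For a nonzero b ≪ a, some prime ideal misses b; the round part of its complement contains a. -/
theorem exists_mem (h : IsMVD ll) {a : B} (ha : a ≠ ⊥) : ∃ p : MVDPoint ll, a ∈ p.carrier := by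
  obtain ⟨b, hb, hba⟩ := h.ll6 a ha
  have hd : Disjoint (Order.PFilter.principal b : Set B) (Order.Ideal.principal (⊥ : B)) :=
    Set.disjoint_left.2 fun x hx hx' => hb (le_bot_iff.1 (le_trans hx hx'))
  obtain ⟨J, hJ, -, hbJ⟩ := DistribLattice.prime_ideal_of_disjoint_filter_ideal hd
  have hbJ : b ∉ J := fun h1 => Set.disjoint_left.1 hbJ (le_refl b) h1
  refine ⟨ofPrimeFilter h {x | x ∉ J} (fun hxy hx hy => hx (J.lower hxy hy))
    (fun hx hy hxy => (hJ.mem_or_mem hxy).elim hx hy) (fun h1 => h1 J.bot_mem) (fun {x y} hxy => ?_)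
    ⟨b, hbJ, h.top_of hba⟩, b, hbJ, hba⟩
  by_contra hn
  simp only [Set.mem_ofPred_eq, not_or, not_not] at hn
  refine hbJ (J.lower ?_ (Order.Ideal.sup_mem hn.1 hn.2))
  have h1 : y ⊔ xᶜ = ⊤ :=
    top_le_iff.1 (le_trans (sup_compl_eq_top (x := x)).ge (sup_le_sup_right (h.ll1 _ _ hxy) _))
  rw [h1]
  exact le_top

theorem basicOpen_nonempty_iff (h : IsMVD ll) {a : B} : (basicOpen ll a).Nonempty ↔ a ≠ ⊥ := by
  refine ⟨?_, exists_mem h⟩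
  rintro ⟨p, hp⟩ rfl
  exact p.bot_notMem hp

theorem closure_basicOpen (h : IsMVD ll) (a : B) :
    closure (basicOpen ll a) = (basicOpen ll aᶜ)ᶜ := by
  ext p
  rw [isTopologicalBasis_basicOpen.mem_closure_iff, Set.forall_mem_range]
  simp only [← basicOpen_inf, basicOpen_nonempty_iff h, mem_basicOpen, Set.mem_compl_iff]
  constructor
  · intro hp hpa
    exact hp _ hpa (compl_inf_self a)
  · intro hpa c hc hca
    exact hpa (p.mem_of_le (le_compl_iff_disjoint_right.2 (disjoint_iff.2 hca)) hc)

theorem closure_basicOpen_subset (h : IsMVD ll) {a b : B} (hab : ll a b) :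
    closure (basicOpen ll a) ⊆ basicOpen ll b := by
  rw [closure_basicOpen h]
  exact fun p hp => (p.prime hab).resolve_right hp

/-- An ultrafilter on the closure yields the filter of all d whose basic open set it contains. This
filter is ≪-prime because `basicOpen_union_of_ll` covers the space, and its round part is the limit.
-/
theorem isCompact_closure_basicOpen (h : IsMVD ll) {a : B} (ha : ll a ⊤) :
    IsCompact (closure (basicOpen ll a)) := by
  obtain ⟨t, hat, ht⟩ := h.ll5 _ _ ha
  rw [isCompact_iff_ultrafilter_le_nhds]
  intro 𝒰 h𝒰
  have h𝒰 : closure (basicOpen ll a) ∈ 𝒰 := Filter.le_principal_iff.1 h𝒰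
  let p : MVDPoint ll := ofPrimeFilter h {d | basicOpen ll d ∈ 𝒰}
    (fun hxy hx => Filter.mem_of_superset hx (basicOpen_mono hxy))
    (fun {x y} hx hy => by
      change basicOpen ll (x ⊓ y) ∈ 𝒰
      rw [basicOpen_inf]
      exact Filter.inter_mem hx hy)
    (fun h0 => 𝒰.empty_notMem (by rwa [Set.mem_ofPred_eq, basicOpen_bot] at h0))
    (fun {x y} hxy => by
      have h1 : basicOpen ll y ∪ basicOpen ll xᶜ ∈ 𝒰 := by
        rw [basicOpen_union_of_ll hxy]
        exact Filter.univ_mem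
      exact Ultrafilter.union_mem_iff.1 h1)
    ⟨t, Filter.mem_of_superset h𝒰 (closure_basicOpen_subset h hat), ht⟩
  have hp : (𝒰 : Filter (MVDPoint ll)) ≤ nhds p := by
    intro s hs
    obtain ⟨_, ⟨c, rfl⟩, ⟨d, hd, hdc⟩, hcs⟩ := isTopologicalBasis_basicOpen.mem_nhds_iff.1 hs
    exact Filter.mem_of_superset hd ((basicOpen_mono (h.ll1 _ _ hdc)).trans hcs)
  exact ⟨p, isClosed_closure.mem_of_frequently_of_tendsto
    (Filter.Eventually.frequently (f := (𝒰 : Filter (MVDPoint ll))) h𝒰) hp, hp⟩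

theorem locallyCompactSpace (h : IsMVD ll) : LocallyCompactSpace (MVDPoint ll) := by
  refine LocallyCompactSpace.mk fun p s hs => ?_
  obtain ⟨_, ⟨a, rfl⟩, ha, has⟩ := isTopologicalBasis_basicOpen.mem_nhds_iff.1 hs
  obtain ⟨b, hb, hba⟩ := p.round ha
  exact ⟨closure (basicOpen ll b),
    Filter.mem_of_superset ((isOpen_basicOpen b).mem_nhds hb) subset_closure,
    (closure_basicOpen_subset h hba).trans has, isCompact_closure_basicOpen h (h.top_of hba)⟩

theorem basicOpen_subset_iff (h : IsMVD ll) {a b : B} :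
    basicOpen ll a ⊆ basicOpen ll b ↔ a ≤ b := by
  refine ⟨fun hab => ?_, basicOpen_mono⟩
  by_contra hle
  have hne : a ⊓ bᶜ ≠ ⊥ := fun h0 => hle (disjoint_compl_right_iff.1 (disjoint_iff.2 h0))
  obtain ⟨p, hp⟩ := exists_mem h hne
  exact p.compl_notMem (hab (p.mem_of_le inf_le_left hp)) (p.mem_of_le inf_le_right hp)

/-- By roundness the basic open sets of elements c ≪ b cover that of b; these c are closed under
joins, so compactness leaves a single one. -/
theorem exists_ll_of_closure_subset (h : IsMVD ll) {a b : B}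
    (hc : IsCompact (closure (basicOpen ll a)))
    (hab : closure (basicOpen ll a) ⊆ basicOpen ll b) : ll a b := by
  have key : ∃ c, ll c b ∧ closure (basicOpen ll a) ⊆ basicOpen ll c := by
    refine hc.induction_on (p := fun s => ∃ c, ll c b ∧ s ⊆ basicOpen ll c)
      ⟨⊥, h.bot_left b, Set.empty_subset _⟩ ?_ ?_ ?_
    · rintro s t hst ⟨c, hcb, htc⟩
      exact ⟨c, hcb, hst.trans htc⟩
    · rintro s t ⟨c, hcb, hsc⟩ ⟨d, hdb, htd⟩
      exact ⟨c ⊔ d, h.ll4 _ _ _ hcb hdb, Set.union_subset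
        (hsc.trans (basicOpen_mono le_sup_left)) (htd.trans (basicOpen_mono le_sup_right))⟩
    · intro p hp
      obtain ⟨c, hcp, hcb⟩ := p.round (hab hp)
      exact ⟨basicOpen ll c, mem_nhdsWithin_of_mem_nhds ((isOpen_basicOpen c).mem_nhds hcp), c,
        hcb, Set.Subset.rfl⟩
  obtain ⟨c, hcb, hac⟩ := key
  exact h.mono_left ((basicOpen_subset_iff h).1 (subset_closure.trans hac)) hcb

/-- The regular open set of the points containing a given element. -/
def basicRegOpen (h : IsMVD ll) (a : B) : RegOpens (MVDPoint ll) :=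
  ⟨⟨basicOpen ll a, isOpen_basicOpen a⟩, by
    apply Opens.ext
    rw [Opens.coe_compl_eq_compl_closure, Opens.coe_compl_eq_compl_closure, Opens.coe_mk,
      closure_basicOpen h, compl_compl, closure_basicOpen h, compl_compl, compl_compl]⟩

end BooleanAlgebra

variable {B : Type u} [CompleteBooleanAlgebra B] {ll : B → B → Prop}

theorem basicRegOpen_surjective (h : IsMVD ll) :
    Function.Surjective (basicRegOpen (ll := ll) h) := by
  intro U
  refine ⟨sSup {c | basicOpen ll c ⊆ U.val}, RegOpens.ext_mem fun p => ⟨fun hp => ?_, fun hp => ?_⟩⟩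
  -- Infinite distributivity shows that every basic neighbourhood of a point of the supremum's basic
  -- set meets U. That basic set thus lies in the closure of U, hence in U by regularity.
  · rw [← compl_compl U, RegOpens.mem_compl_iff]
    intro hpU
    obtain ⟨q, hq, hqU⟩ := mem_closure_iff.1 hpU _ (isOpen_basicOpen _) hp
    rw [SetLike.mem_coe, RegOpens.mem_compl_iff] at hqU
    refine hqU (isTopologicalBasis_basicOpen.mem_closure_iff.2 ?_)
    rintro _ ⟨c, rfl⟩ hc
    have hne : sSup {c | basicOpen ll c ⊆ U.val} ⊓ c ≠ ⊥ :=
      (basicOpen_nonempty_iff h).1 ⟨q, q.inf_mem hq hc⟩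
    rw [sSup_inf_eq] at hne
    simp only [ne_eq, iSup_eq_bot, not_forall] at hne
    obtain ⟨d, hd, hdc⟩ := hne
    obtain ⟨r, hr⟩ := exists_mem h hdc
    exact ⟨r, r.mem_of_le inf_le_right hr, hd (r.mem_of_le inf_le_left hr)⟩
  · obtain ⟨_, ⟨c, rfl⟩, hc, hcU⟩ :=
      isTopologicalBasis_basicOpen.mem_nhds_iff.1 (U.val.isOpen.mem_nhds hp)
    exact p.mem_of_le (le_sSup hcU) hc

/-- A complete MVD-algebra is isomorphic to the algebra of regular open sets of its points. -/
noncomputable def orderIso (h : IsMVD ll) : B ≃o RegOpens (MVDPoint ll) where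
  toEquiv := Equiv.ofBijective (basicRegOpen h)
    ⟨fun _ _ hab => le_antisymm
      ((basicOpen_subset_iff h).1 (RegOpens.le_iff.1 hab.le))
      ((basicOpen_subset_iff h).1 (RegOpens.le_iff.1 hab.ge)),
    basicRegOpen_surjective h⟩
  map_rel_iff' := basicOpen_subset_iff h

theorem compactlyIn_orderIso_iff (h : IsMVD ll) {a b : B} :
    RegOpens.CompactlyIn (orderIso h a) (orderIso h b) ↔ ll a b :=
  ⟨fun hab => exists_ll_of_closure_subset h hab.1 hab.2,
    fun hab => ⟨isCompact_closure_basicOpen h (h.top_of hab), closure_basicOpen_subset h hab⟩⟩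

end MVDPoint

/-- The space of points of a complete MVD-algebra. -/
def CompleteMVD.toOPLC (A : CompleteMVD.{u}) : OPLC.{u} :=
  { carrier := MVDPoint A.ll
    locallyCompact := MVDPoint.locallyCompactSpace A.isMVD }

theorem lowerAdjoint_orderIso {A B : Type u} [CompleteBooleanAlgebra A] [CompleteBooleanAlgebra B]
    (e : A ≃o B) (b : B) : lowerAdjoint (e : CompleteLatticeHom A B) b = e.symm b :=
  (lowerAdjoint_gc (e : CompleteLatticeHom A B)).l_unique e.symm.to_galoisConnection
    (fun _ => rfl)

/-- An isomorphism of Boolean algebras that preserves and reflects `≪` is an **IPA**-morphism. -/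
def IPAHom.ofOrderIso {A B : CompleteMVD.{u}} (e : A.carrier ≃o B.carrier)
    (h : ∀ {a b}, B.ll (e a) (e b) ↔ A.ll a b) : IPAHom A B where
  toHom := (e : CompleteLatticeHom A.carrier B.carrier)
  isMor :=
    have so : ∀ a b, B.ll b (e a) → A.ll (lowerAdjoint (e : CompleteLatticeHom _ _) b) a := by
      intro a b hb
      rwa [lowerAdjoint_orderIso, ← h, e.apply_symm_apply]
    { S2 := fun b hb => so ⊤ b (by rwa [map_top])
      ES1 := fun a b hab => h.2 hab
      S3 := fun a ha => by
        rw [← map_top e]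
        exact h.2 ha
      SO := so }

/-- An isomorphism of Boolean algebras that preserves and reflects `≪` is an isomorphism in
**IPA**. -/
def IPA.isoOfOrderIso {A B : CompleteMVD.{u}} (e : A.carrier ≃o B.carrier)
    (h : ∀ {a b}, B.ll (e a) (e b) ↔ A.ll a b) : @Iso IPA.{u} _ A B where
  hom := IPAHom.ofOrderIso e h
  inv := IPAHom.ofOrderIso e.symm (fun {a b} => by
    rw [← h, e.apply_symm_apply, e.apply_symm_apply])
  hom_inv_id := IPAHom.ext (CompleteLatticeHom.ext fun a => e.symm_apply_apply a)
  inv_hom_id := IPAHom.ext (CompleteLatticeHom.ext fun a => e.apply_symm_apply a)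

/-- A complete MVD-algebra is isomorphic to the MVD-algebra of regular open sets of its points. -/
noncomputable def CompleteMVD.regOpensIso (A : CompleteMVD.{u}) :
    @Iso IPA.{u} _ A A.toOPLC.toMVD :=
  IPA.isoOfOrderIso (A := A) (B := A.toOPLC.toMVD) (MVDPoint.orderIso A.isMVD)
    (MVDPoint.compactlyIn_orderIso_iff A.isMVD)

instance regOpensFunctor_essSurj : regOpensFunctor.{u}.EssSurj where
  mem_essImage A := ⟨Opposite.op (CompleteMVD.toOPLC A), ⟨(CompleteMVD.regOpensIso A).symm⟩⟩

/- ### Fullness -/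

theorem inf_map_le_map_inf {A B : Type u} [CompleteBooleanAlgebra A] [CompleteBooleanAlgebra B]
    (φ : CompleteLatticeHom A B) (a b : A) : φ a ⊓ φ b ≤ φ (a ⊓ b) := (map_inf φ a b).ge

namespace RegOpens

variable {X Y : Type u} [TopologicalSpace X] [T2Space X] [LocallyCompactSpace X]
  [TopologicalSpace Y] [T2Space Y] [LocallyCompactSpace Y]

/-- A relatively compact member T makes the closures of the sets T ∧ U a directed family of nonempty
compact sets, so they share a point y. Roundness replaces closures by members; primeness shows that
every regular neighbourhood of y is a member. -/
theorem exists_eq_of_mvdPoint (p : MVDPoint (CompactlyIn (X := Y))) :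
    ∃ y, ∀ U : RegOpens Y, y ∈ U.val ↔ U ∈ p.carrier := by
  obtain ⟨T, hT⟩ := p.nonempty
  obtain ⟨T, hT, hT1⟩ := p.round hT
  have hne : (⋂ U : p.carrier, closure ((T ⊓ U.1).val : Set Y)).Nonempty := by
    have : Nonempty p.carrier := ⟨⟨T, hT⟩⟩
    refine IsCompact.nonempty_iInter_of_directed_nonempty_isCompact_isClosed _ ?_ ?_ ?_
      fun _ => isClosed_closure
    · rintro ⟨U, hU⟩ ⟨V, hV⟩
      exact ⟨⟨U ⊓ V, p.inf_mem hU hV⟩, closure_mono (le_iff.1 (inf_le_inf_left T inf_le_left)),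
        closure_mono (le_iff.1 (inf_le_inf_left T inf_le_right))⟩
    · rintro ⟨U, hU⟩
      obtain ⟨y, hy⟩ := ne_bot_iff.1
        (fun h0 => p.bot_notMem (h0 ▸ p.inf_mem hT hU) : T ⊓ U ≠ ⊥)
      exact ⟨y, subset_closure hy⟩
    · exact fun U => hT1.1.of_isClosed_subset isClosed_closure (closure_mono (le_iff.1 inf_le_left))
  obtain ⟨y, hy⟩ := hne
  have hy : ∀ U ∈ p.carrier, y ∈ U.val := by
    intro U hU
    obtain ⟨V, hV, hVU⟩ := p.round hU
    exact hVU.2 (closure_mono (le_iff.1 inf_le_right) (Set.mem_iInter.1 hy ⟨V, hV⟩))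
  refine ⟨y, fun U => ⟨fun hyU => ?_, hy U⟩⟩
  obtain ⟨V, hyV, hV⟩ := exists_mem_compactlyIn U.val.isOpen hyU
  refine (p.prime (show CompactlyIn V U from hV)).resolve_right fun h => ?_
  exact mem_compl_iff.1 (hy _ h) (subset_closure hyV)

/-- The point of the algebra of regular open sets determined by a homomorphism and a point. -/
def point (φ : CompleteLatticeHom (RegOpens Y) (RegOpens X))
    (es1 : ∀ U V, CompactlyIn U V → CompactlyIn (φ U) (φ V))
    (so : ∀ U V, CompactlyIn V (φ U) → CompactlyIn (lowerAdjoint φ V) U) (x : X) :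
    MVDPoint (CompactlyIn (X := Y)) where
  carrier := {U | x ∈ (φ U).val}
  nonempty := ⟨⊤, by
    rw [Set.mem_ofPred_eq, map_top]
    trivial⟩
  mem_of_le := fun h hx => le_iff.1 (OrderHomClass.mono φ h) hx
  inf_mem := fun {U V} hU hV =>
    le_iff.1 (inf_map_le_map_inf φ U V) (And.intro hU hV)
  bot_notMem := by
    rw [Set.mem_ofPred_eq, map_bot]
    exact fun h => h
  round := fun {U} hU => by
    obtain ⟨W, hxW, hW⟩ := exists_mem_compactlyIn (φ U).val.isOpen hU
    -- SO provides the smaller member, since W ≤ φ(φ_Λ(W)) keeps x inside.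
    exact ⟨lowerAdjoint φ W, le_iff.1 ((lowerAdjoint_gc φ).le_u_l W) hxW, so U W hW⟩
  prime := fun {U V} hUV => by
    rw [Set.mem_ofPred_eq, Set.mem_ofPred_eq, map_compl', or_iff_not_imp_right, mem_compl_iff,
      not_not]
    exact fun hx => (es1 U V hUV).2 hx

theorem exists_map (φ : CompleteLatticeHom (RegOpens Y) (RegOpens X))
    (es1 : ∀ U V, CompactlyIn U V → CompactlyIn (φ U) (φ V))
    (so : ∀ U V, CompactlyIn V (φ U) → CompactlyIn (lowerAdjoint φ V) U) :
    ∃ f : X → Y, ∀ x U, f x ∈ U.val ↔ x ∈ (φ U).val := by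
  choose f hf using fun x => exists_eq_of_mvdPoint (point φ es1 so x)
  exact ⟨f, hf⟩

theorem isOpenPerfect_of_forall_mem_iff (φ : CompleteLatticeHom (RegOpens Y) (RegOpens X))
    (es1 : ∀ U V, CompactlyIn U V → CompactlyIn (φ U) (φ V))
    {f : X → Y} (hf : ∀ x U, f x ∈ U.val ↔ x ∈ (φ U).val) : IsOpenPerfect f := by
  have hcont : Continuous f := by
    refine continuous_iff_continuousAt.2 fun x s hs => Filter.mem_map.2 ?_
    obtain ⟨t, hts, ht, hxt⟩ := mem_nhds_iff.1 hs
    obtain ⟨U, hxU, -, hU⟩ := exists_mem_compactlyIn ht hxt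
    refine Filter.mem_of_superset ((φ U).val.isOpen.mem_nhds ((hf x U).1 hxU)) fun z hz => ?_
    exact hts (hU (subset_closure ((hf z U).2 hz)))
  have hopen : IsOpenMap f := by
    refine isOpenMap_iff_nhds_le.2 fun x s hs => ?_
    obtain ⟨t, hts, ht, hxt⟩ := mem_nhds_iff.1 (Filter.mem_map.1 hs)
    obtain ⟨V, hxV, hVc, hVt⟩ := exists_mem_compactlyIn ht hxt
    have hxL : f x ∈ (lowerAdjoint φ V).val :=
      (hf x _).2 (le_iff.1 ((lowerAdjoint_gc φ).le_u_l V) hxV)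
    refine Filter.mem_of_superset ((lowerAdjoint φ V).val.isOpen.mem_nhds hxL) fun y hy => ?_
    -- The neighbourhood φ_Λ(V) of f(x) lies in the compact image of the closure of V. A y outside
    -- that image has a regular neighbourhood U disjoint from it, so V ≤ φ(U*), whence y ∈ φ_Λ(V) ≤
    -- U*, a contradiction.
    by_contra hys
    have hyV : y ∉ f '' closure (V.val : Set X) := by
      rintro ⟨z, hz, rfl⟩
      exact hys (hts (hVt hz))
    obtain ⟨U, hyU, -, hU⟩ :=
      exists_mem_compactlyIn (hVc.image hcont).isClosed.isOpen_compl hyV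
    have hVU : V ≤ φ Uᶜ := fun z hz => (hf z Uᶜ).1 <| mem_compl_iff.2 fun hzU =>
      hU hzU (Set.mem_image_of_mem f (subset_closure hz))
    exact mem_compl_iff.1 (le_iff.1 ((lowerAdjoint_gc φ _ _).2 hVU) hy) (subset_closure hyU)
  have hproper : IsProperMap f := by
    refine isProperMap_iff_isCompact_preimage.2 ⟨hcont, fun K hK => ?_⟩
    obtain ⟨U, hKU, hU, -⟩ := exists_compactlyIn_of_isCompact hK isOpen_univ (Set.subset_univ K)
    -- ES1 against the top element says that φ(U) has compact closure, and this closure contains the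
    -- closed preimage of K.
    exact (es1 U ⊤ (compactlyIn_top.2 hU)).1.of_isClosed_subset (hK.isClosed.preimage hcont)
      fun x hx => subset_closure ((hf x U).1 (hKU hx))
  exact ⟨hcont, hopen, hproper.isClosedMap, fun y => hproper.isCompact_preimage isCompact_singleton⟩

end RegOpens

theorem OPLCHom.exists_toMVDHom_eq {X Y : OPLC.{u}} (φ : IPAHom Y.toMVD X.toMVD) :
    ∃ f : OPLCHom X Y, f.toMVDHom = φ := by
  obtain ⟨f, hf⟩ := RegOpens.exists_map φ.toHom φ.isMor.ES1 φ.isMor.SO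
  refine ⟨⟨f, RegOpens.isOpenPerfect_of_forall_mem_iff φ.toHom φ.isMor.ES1 hf⟩, ?_⟩
  exact IPAHom.ext (CompleteLatticeHom.ext fun U => RegOpens.ext_mem fun x => hf x U)

instance regOpensFunctor_full : regOpensFunctor.{u}.Full where
  map_surjective φ :=
    let ⟨f, hf⟩ := OPLCHom.exists_toMVDHom_eq φ
    ⟨Quiver.Hom.op f, hf⟩

theorem mainTheorem5 :
    Nonempty (Cat.of OPAL.{u} ≅ Cat.of IPA.{u}) ∧
      Nonempty (OPLC.{u}ᵒᵖ ≌ IPA.{u}) := by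
  have : regOpensFunctor.{u}.IsEquivalence := {}
  exact ⟨⟨opalIsoIPA⟩, ⟨regOpensFunctor.asEquivalence⟩⟩
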